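/- For $1\le n\le N$ identify $\mathbb{R}^n$ with $\mathbb{R}^n\times\{0\}\subset\mathbb{R}^N$, and let $B^n(x,r)$, $B^N(x,r)$ denote the closed balls of centre $x$ and radius $r$ in $\mathbb{R}^n$, $\mathbb{R}^N$. A map $f:X\to Z$ between metric spaces is quasisymmetric if it is a homeomorphism onto its image and there is an increasing homeomorphism $\eta:(0,\infty)\to(0,\infty)$ such that $d(a,x)\le t\,d(b,x)$ implies $d(f(a),f(x))\le\eta(t)\,d(f(b),f(x))$ for all $a,b,x\in X$ and $t>0$. For $S\subset X$, let $H_f(S)\in[1,\infty]$ be the infimum of the $H\in[1,\infty)$ such that $d(a,x)\le d(b,x)$ implies $d(f(a),f(x))\le H\,d(f(b),f(x))$ for all $a,b,x\in S$, and put $\widetilde H_f(S)=H_f(S)-1$. Let $E\subset X\subset\mathbb{R}^n$ and $\varepsilon>0$. A map $g:X\to\mathbb{R}^N$ is $\varepsilon$-almost affine over $E$ if there are affine maps $A_{x,r}:\mathbb{R}^n\to\mathbb{R}^N$ ($x\in E$, $r>0$), with linear parts $A_{x,r}'$, such that, for the operator norm $\|\cdot\|$, $$\|A_{x,r}'-A_{y,s}'\|\le\varepsilon\min\{\|A_{x,r}'\|,\|A_{y,s}'\|\}$$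 for all $x,y\in E$ and $r,s>0$ with $|x-y|\le\max\{r,s\}$ and $1/2\le r/s\le 2$, and $$\sup_{z\in E\cap B^n(x,r)}|g(z)-A_{x,r}(z)|\le\varepsilon\|A_{x,r}'\|\,r\qquad\text{for all }x\in E,\ r>0.$$ **Theorem.** Let $N\ge2$. For every $\tau>0$ there is $\tau_*=\tau_*(\tau,N)>0$ such that, for every $1\le n\le N$: if $B^N(x,3r)\subset Y\subset\mathbb{R}^N$ for some $x\in\mathbb{R}^n$ and $r>0$, if $f:Y\to\mathbb{R}^N$ is quasisymmetric, and if $\widetilde H_f(B^N(x,3r))\le\tau_*$, then $f|_{Y\cap\mathbb{R}^n}$ is $\tau$-almost affine over $B^n(x,r)$. -/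

import Mathlib

open scoped ENNReal

noncomputable section

/-- A map `f` between metric spaces is quasisymmetric if it is a homeomorphism onto its image and
there is an increasing homeomorphism `η : (0, ∞) → (0, ∞)` such that `d(a, x) ≤ t d(b, x)` implies
`d(f a, f x) ≤ η(t) d(f b, f x)`. -/
def IsQuasisymmetric {X Y : Type*} [MetricSpace X] [MetricSpace Y] (f : X → Y) : Prop :=
  Topology.IsEmbedding f ∧
    ∃ η : Set.Ioi (0 : ℝ) ≃ₜ Set.Ioi (0 : ℝ), StrictMono η ∧
      ∀ (a b x : X) (t : Set.Ioi (0 : ℝ)),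
        dist a x ≤ (t : ℝ) * dist b x → dist (f a) (f x) ≤ (η t : ℝ) * dist (f b) (f x)

/-- The weak quasisymmetry constant `H_f(S) ∈ [1, ∞]` of `f` on a subset `S` of its domain: the
infimum of the real numbers `H ≥ 1` such that `d(a, x) ≤ d(b, x)` implies
`d(f a, f x) ≤ H d(f b, f x)` for all `a, b, x ∈ S` (it is `∞` if there is no such `H`). -/
def weakQuasisymmetryConst {X Y : Type*} [MetricSpace X] [MetricSpace Y] (f : X → Y)
    (S : Set X) : ℝ≥0∞ :=
  ⨅ (H : ℝ) (_ : 1 ≤ H ∧ ∀ a ∈ S, ∀ b ∈ S, ∀ x ∈ S,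
      dist a x ≤ dist b x → dist (f a) (f x) ≤ H * dist (f b) (f x)), ENNReal.ofReal H

/-- `H̃_f(S) = H_f(S) - 1`. (Always `1 ≤ H_f(S)`, so the subtraction does not truncate.) -/
def weakQuasisymmetryDefect {X Y : Type*} [MetricSpace X] [MetricSpace Y] (f : X → Y)
    (S : Set X) : ℝ≥0∞ :=
  weakQuasisymmetryConst f S - 1

/-- For `n ≤ N`, the identification of `ℝⁿ` with the subspace `ℝⁿ × {0}` of `ℝᴺ`. -/
def euclideanIncl (n N : ℕ) (x : EuclideanSpace ℝ (Fin n)) : EuclideanSpace ℝ (Fin N) :=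
  WithLp.toLp 2 fun i => if h : (i : ℕ) < n then x ⟨i, h⟩ else 0

/-- The operator norm `‖L‖` (with respect to the Euclidean norms) of a linear map `ℝⁿ → ℝᴺ`. -/
def linearOpNorm {n N : ℕ}
    (L : EuclideanSpace ℝ (Fin n) →ₗ[ℝ] EuclideanSpace ℝ (Fin N)) : ℝ :=
  ‖LinearMap.toContinuousLinearMap L‖

/-- A family `A x r` of affine maps over `E` (only the members with `x ∈ E` and `r > 0` matter)
is `ε`-compatible if `‖A'_{x,r} - A'_{y,s}‖ ≤ ε min {‖A'_{x,r}‖, ‖A'_{y,s}‖}` whenever `x, y ∈ E`,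
`r, s > 0`, `|x - y| ≤ max {r, s}` and `1/2 ≤ r/s ≤ 2`. -/
def IsCompatibleFamily {n N : ℕ} (E : Set (EuclideanSpace ℝ (Fin n)))
    (A : EuclideanSpace ℝ (Fin n) → ℝ →
      (EuclideanSpace ℝ (Fin n) →ᵃ[ℝ] EuclideanSpace ℝ (Fin N))) (ε : ℝ) : Prop :=
  ∀ x ∈ E, ∀ y ∈ E, ∀ r s : ℝ, 0 < r → 0 < s → dist x y ≤ max r s → 1 / 2 ≤ r / s → r / s ≤ 2 →
    linearOpNorm ((A x r).linear - (A y s).linear) ≤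
      ε * min (linearOpNorm (A x r).linear) (linearOpNorm (A y s).linear)

/-- A map `f : X → ℝᴺ`, `X ⊆ ℝⁿ`, is `ε`-almost affine over `E ⊆ X` if there is an `ε`-compatible
family of affine maps over `E` with `|f z - A_{x,r} z| ≤ ε ‖A'_{x,r}‖ r` for all
`x ∈ E`, `r > 0` and `z ∈ E ∩ B(x, r)`. -/
def IsAlmostAffineOver {n N : ℕ} {X : Set (EuclideanSpace ℝ (Fin n))}
    (f : X → EuclideanSpace ℝ (Fin N)) (ε : ℝ) (E : Set (EuclideanSpace ℝ (Fin n))) : Prop :=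
  E ⊆ X ∧
    ∃ A : EuclideanSpace ℝ (Fin n) → ℝ →
        (EuclideanSpace ℝ (Fin n) →ᵃ[ℝ] EuclideanSpace ℝ (Fin N)),
      IsCompatibleFamily E A ε ∧
        ∀ x ∈ E, ∀ r : ℝ, 0 < r → ∀ z : X, (z : EuclideanSpace ℝ (Fin n)) ∈ E →
          (z : EuclideanSpace ℝ (Fin n)) ∈ Metric.closedBall x r →
            ‖f z - A x r z‖ ≤ ε * linearOpNorm (A x r).linear * r

/-- The restriction `f|_{Y ∩ ℝⁿ}` of a map `f : Y → ℝᴺ`, `Y ⊆ ℝᴺ`, where `Y ∩ ℝⁿ` is regarded as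
a subset of `ℝⁿ`. -/
def restrictToSubspace (n : ℕ) {N : ℕ} {Y : Set (EuclideanSpace ℝ (Fin N))}
    (f : Y → EuclideanSpace ℝ (Fin N)) :
    (euclideanIncl n N ⁻¹' Y : Set (EuclideanSpace ℝ (Fin n))) → EuclideanSpace ℝ (Fin N) :=
  fun z => f ⟨euclideanIncl n N z, z.2⟩

end

/-! The argument is rigidity plus compactness, carried out in ℝᴺ and only then restricted to ℝⁿ, so
the threshold does not depend on `n`.

Rigidity: with constant `H = 1`, equal distances from a point go to equal distances. Equidistance
encodes orthogonality, so orthogonality is preserved (`WeakQSOn.inner_eq_zero`). Pythagoras then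
makes the squared norm of the image additive in the squared radius, so the map multiplies distances
from the centre by a constant (`WeakQSOn.exists_norm_eq_mul`). Changing the centre gives a linear
isometry (`WeakQSOn.exists_linearIsometry`). Here `N ≥ 2` supplies the second orthogonal direction.

Compactness: normalised maps with `H → 1` converge pointwise to such an isometry, and the weak
inequality itself upgrades this to uniform closeness. Rescaling gives, on every ball where the
defect is small, a similarity close to the map (`exists_similarity_near_of_weakQSOn`).

Conclusion: these similarities, restricted to ℝⁿ, are the required affine maps. Two of them at
comparable scales and nearby centres both approximate the map on a common ball, which forces their
linear parts to be close. -/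

/-- `g` satisfies the weak quasisymmetry inequality with constant `H` on `S`. -/
def WeakQSOn {V : Type*} [PseudoMetricSpace V] (H : ℝ) (g : V → V) (S : Set V) : Prop :=
  ∀ a ∈ S, ∀ b ∈ S, ∀ x ∈ S, dist a x ≤ dist b x → dist (g a) (g x) ≤ H * dist (g b) (g x)

theorem WeakQSOn.dist_eq {V : Type*} [PseudoMetricSpace V] {g : V → V} {S : Set V}
    (hg : WeakQSOn 1 g S) {a b x : V} (ha : a ∈ S) (hb : b ∈ S) (hx : x ∈ S)
    (h : dist a x = dist b x) : dist (g a) (g x) = dist (g b) (g x) := by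
  have h1 := hg a ha b hb x hx h.le
  have h2 := hg b hb a ha x hx h.ge
  linarith

/-- A nonnegative function that is additive on `[0, T]` is linear there. -/
theorem eq_mul_of_additive_of_nonneg {ψ : ℝ → ℝ} {T : ℝ} (hT : 0 < T)
    (hadd : ∀ s t, 0 ≤ s → 0 ≤ t → s + t ≤ T → ψ (s + t) = ψ s + ψ t)
    (hpos : ∀ t, 0 ≤ ψ t) {t : ℝ} (ht : 0 ≤ t) (htT : t ≤ T) : ψ t = t / T * ψ T := by
  have h0 : ψ 0 = 0 := by
    have := hadd 0 0 le_rfl le_rfl (by simpa using hT.le)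
    simp at this
    exact this
  have mono : ∀ s t, 0 ≤ s → s ≤ t → t ≤ T → ψ s ≤ ψ t := by
    intro s t hs hst htT
    have := hadd s (t - s) hs (by linarith) (by linarith)
    rw [add_sub_cancel] at this
    linarith [hpos (t - s)]
  have hmul : ∀ (k : ℕ) (s : ℝ), 0 ≤ s → k * s ≤ T → ψ (k * s) = k * ψ s := by
    intro k s hs
    induction k with
    | zero => simp [h0]
    | succ k ih =>
      intro h
      push_cast at h ⊢
      have h' : (k : ℝ) * s + s ≤ T := by linarith
      rw [add_mul, one_mul, hadd _ _ (by positivity) hs h', ih (by linarith)]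
      ring
  -- Monotonicity squeezes `t` between consecutive multiples of `T / n`, on which additivity already
  -- determines `ψ`.
  have key : ∀ n : ℕ, 0 < n → |ψ t - t / T * ψ T| ≤ ψ T / n := by
    intro n hn
    have hn' : (0 : ℝ) < n := by exact_mod_cast hn
    have e1 : ψ (T / n) = ψ T / n := by
      have := hmul n (T / n) (by positivity) (by rw [mul_div_cancel₀ _ hn'.ne'])
      rw [mul_div_cancel₀ _ hn'.ne'] at this
      rw [this]; field_simp
    have hP := hpos T
    set k := ⌊n * (t / T)⌋₊ with hk
    have hk1 : (k : ℝ) ≤ n * (t / T) := Nat.floor_le (by positivity)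
    have hk2 : n * (t / T) < k + 1 := Nat.lt_floor_add_one _
    have hk1' : (k : ℝ) * (T / n) ≤ t := by
      calc (k : ℝ) * (T / n) ≤ n * (t / T) * (T / n) := by gcongr
        _ = t := by field_simp
    have hk2' : t ≤ (k : ℝ) * (T / n) + T / n := by
      calc t = n * (t / T) * (T / n) := by field_simp
        _ ≤ (k + 1) * (T / n) := by gcongr
        _ = _ := by ring
    have ek := hmul k (T / n) (by positivity) (by linarith)
    have lo := mono _ _ (by positivity) hk1' htT
    have hi : ψ t ≤ ψ (k * (T / n)) + ψ (T / n) := by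
      have := hadd (k * (T / n)) (t - k * (T / n)) (by positivity) (by linarith) (by linarith)
      rw [add_sub_cancel] at this
      have h2 := mono (t - k * (T / n)) (T / n) (by linarith) (by linarith)
        (div_le_self hT.le (by exact_mod_cast hn))
      linarith
    rw [ek, e1] at lo hi
    have a1 : (k : ℝ) * (ψ T / n) ≤ t / T * ψ T := by
      calc (k : ℝ) * (ψ T / n) ≤ n * (t / T) * (ψ T / n) := by gcongr
        _ = _ := by field_simp
    have a2 : t / T * ψ T ≤ (k : ℝ) * (ψ T / n) + ψ T / n := by
      calc t / T * ψ T = n * (t / T) * (ψ T / n) := by field_simp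
        _ ≤ (k + 1) * (ψ T / n) := by gcongr
        _ = _ := by ring
    rw [abs_le]
    constructor <;> linarith
  have hlim : Filter.Tendsto (fun n : ℕ => ψ T / n) Filter.atTop (nhds 0) :=
    tendsto_const_div_atTop_nhds_zero_nat _
  have := ge_of_tendsto hlim (Filter.eventually_atTop.2 ⟨1, fun n hn => key n hn⟩)
  have := abs_nonpos_iff.1 this
  linarith

theorem WeakQSOn.norm_eq {V : Type*} [NormedAddCommGroup V] {g : V → V} {R : ℝ} (hg : WeakQSOn 1 g (Metric.closedBall 0 R))
    (h0 : g 0 = 0) {a b : V} (ha : ‖a‖ ≤ R) (hab : ‖a‖ = ‖b‖) : ‖g a‖ = ‖g b‖ := by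
  have := hg.dist_eq (a := a) (b := b) (x := 0) (by simpa using ha) (by simpa [← hab] using ha)
    (by simpa using (norm_nonneg a).trans ha) (by simpa using hab)
  simpa [h0] using this

/-! ### Rigidity of weakly 1-quasisymmetric maps -/

section Rigidity

variable {V : Type*} [NormedAddCommGroup V] [InnerProductSpace ℝ V]

theorem inner_sub_eq_zero_of_dist_eq {p q c : V} (hn : ‖p‖ = ‖q‖) (hd : dist p c = dist q c) :
    inner ℝ c (p - q) = 0 := by
  rw [dist_eq_norm, dist_eq_norm] at hd
  have h1 := norm_sub_sq_real p c
  have h2 := norm_sub_sq_real q c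
  rw [hd, hn] at h1
  rw [inner_sub_right, real_inner_comm, real_inner_comm q c]
  linarith

/-- A weakly `1`-quasisymmetric map fixing the origin of a Euclidean space preserves orthogonality
of vectors. -/
theorem WeakQSOn.inner_eq_zero [FiniteDimensional ℝ V] {g : V → V} {R : ℝ}
    (hg : WeakQSOn 1 g (Metric.closedBall 0 R)) (h0 : g 0 = 0) {a b : V}
    (ha : ‖a‖ ≤ R) (hb : ‖b‖ ≤ R) (hab : inner ℝ a b = 0) : inner ℝ (g a) (g b) = 0 := by
  by_cases hga : g a = 0
  · simp [hga]
  have ha0 : a ≠ 0 := by rintro rfl; exact hga h0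
  have hr : 0 < ‖a‖ := norm_pos_iff.2 ha0
  have hmem : ∀ c : V, c ∈ Metric.closedBall (0 : V) R ↔ ‖c‖ ≤ R := by simp
  have hd : 0 < Module.finrank ℝ V := Module.finrank_pos_iff_exists_ne_zero.2 ⟨a, ha0⟩
  let i₀ : Fin (Module.finrank ℝ V) := ⟨0, hd⟩
  obtain ⟨B, hB⟩ := Orthonormal.exists_orthonormalBasis_extension_of_card_eq (𝕜 := ℝ) (E := V)
    (ι := Fin (Module.finrank ℝ V)) (by simp) (v := fun _ => ‖a‖⁻¹ • a) (s := {i₀})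
    (by
      constructor
      · intro i
        simp [norm_smul, hr.ne']
      · intro i j hij
        exact absurd (Subsingleton.elim i j) hij)
  have hB0 : ‖a‖ • B i₀ = a := by
    rw [hB i₀ rfl, smul_smul, mul_inv_cancel₀ hr.ne', one_smul]
  let p : Fin (Module.finrank ℝ V) → V := fun i => ‖a‖ • B i
  have hp : ∀ i, ‖p i‖ = ‖a‖ := fun i => by simp [p, norm_smul]
  -- The differences of images of antipodal points will form an orthogonal basis of the target. This
  -- uses that source and target have the same dimension.
  let u : Fin (Module.finrank ℝ V) → V := fun i => g (p i) - g (-p i)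
  have hu0 : ∀ i, u i ≠ 0 := by
    intro i hi
    have h1 := hg 0 ((hmem _).2 (by simpa using hr.le.trans ha)) (-p i)
      ((hmem _).2 (by rw [norm_neg, hp]; exact ha)) (p i) ((hmem _).2 (by rw [hp]; exact ha))
      (by
        have h2 : -p i - p i = (-2 : ℝ) • p i := by module
        rw [dist_zero_left, dist_eq_norm, h2, norm_smul (-2 : ℝ) (p i), hp]
        norm_num
        linarith)
    rw [dist_comm (g (-p i)), dist_eq_norm (g (p i))] at h1
    have hi' : g (p i) - g (-p i) = 0 := hi
    rw [hi', h0, dist_zero_left, hg.norm_eq h0 (by rw [hp]; exact ha) (hp i)] at h1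
    simp at h1
    exact hga h1
  -- A vector orthogonal to `B i` is equidistant from `±p i`, so its image is equidistant from `g
  -- (±p i)`. These have equal norms, hence the image is orthogonal to their difference.
  have hperp : ∀ i (c : V), ‖c‖ ≤ R → inner ℝ c (B i) = 0 → inner ℝ (g c) (u i) = 0 := by
    intro i c hc hci
    apply inner_sub_eq_zero_of_dist_eq
    · exact hg.norm_eq h0 (by rw [hp]; exact ha) (by rw [norm_neg])
    · refine hg.dist_eq ((hmem _).2 (by rw [hp]; exact ha))
        ((hmem _).2 (by rw [norm_neg, hp]; exact ha)) ((hmem _).2 hc) ?_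
      have hpc : inner ℝ (p i) c = 0 := by
        rw [real_inner_comm]; simp [p, inner_smul_right, hci]
      rw [dist_eq_norm, dist_eq_norm, ← sq_eq_sq₀ (norm_nonneg _) (norm_nonneg _),
        norm_sub_sq_real, norm_sub_sq_real, inner_neg_left, hpc, norm_neg]
      simp
  have hBij : ∀ i j, i ≠ j → inner ℝ (B i) (B j) = 0 := fun i j hij => B.orthonormal.2 hij
  have huu : ∀ i j, i ≠ j → inner ℝ (u i) (u j) = 0 := by
    intro i j hij
    have h1 := hperp j (p i) (by rw [hp]; exact ha) (by simp [p, inner_smul_left, hBij i j hij])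
    have h2 := hperp j (-p i) (by rw [norm_neg, hp]; exact ha)
      (by simp [p, inner_smul_left, hBij i j hij])
    change inner ℝ (g (p i) - g (-p i)) (u j) = 0
    rw [inner_sub_left, h1, h2, sub_zero]
  have hon : Orthonormal ℝ (fun i => ‖u i‖⁻¹ • u i) := by
    constructor
    · intro i
      simp [norm_smul, hu0 i]
    · intro i j hij
      simp [inner_smul_left, inner_smul_right, huu i j hij]
  let C : OrthonormalBasis (Fin (Module.finrank ℝ V)) ℝ V :=
    OrthonormalBasis.mk hon (by
      rw [(hon.linearIndependent).span_eq_top_of_card_eq_finrank' (by simp)])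
  have hC : ∀ i, C i = ‖u i‖⁻¹ • u i := fun i => by simp [C]
  -- Every term vanishes: `g b` is orthogonal to `u i₀`, and `g a` to all the other `u i`.
  rw [← C.sum_inner_mul_inner]
  refine Finset.sum_eq_zero fun i _ => ?_
  by_cases hi : i = i₀
  · subst hi
    have : inner ℝ (g b) (u i₀) = 0 := hperp i₀ b hb (by
      rw [hB i₀ rfl, inner_smul_right, real_inner_comm, hab, mul_zero])
    rw [hC, inner_smul_left _ (g b), real_inner_comm (g b), this]
    simp
  · have : inner ℝ (g a) (u i) = 0 := hperp i a ha (by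
      rw [← hB0, inner_smul_left, hBij _ _ (Ne.symm hi), mul_zero])
    rw [hC, inner_smul_right, this]
    simp

theorem exists_norm_eq_one_inner_eq_zero [FiniteDimensional ℝ V]
    (hV : 2 ≤ Module.finrank ℝ V) :
    ∃ e e' : V, ‖e‖ = 1 ∧ ‖e'‖ = 1 ∧ inner ℝ e e' = 0 := by
  let B := stdOrthonormalBasis ℝ V
  exact ⟨B ⟨0, by omega⟩, B ⟨1, by omega⟩, B.orthonormal.1 _, B.orthonormal.1 _,
    B.orthonormal.2 (by simp)⟩

/-- Orthogonality is preserved, so Pythagoras applies in the image and `t ↦ ‖g (√t • e)‖ ^ 2` is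
additive; a nonnegative additive function is linear. The hypotenuse `b - a` does not start at the
origin, so its image length is carried to one that does through an auxiliary point `c` with `‖c‖ =
‖c - a‖ = ‖b - a‖`. -/
theorem WeakQSOn.exists_norm_eq_mul [FiniteDimensional ℝ V] (hV : 2 ≤ Module.finrank ℝ V)
    {g : V → V} {R : ℝ} (hR : 0 < R) (hg : WeakQSOn 1 g (Metric.closedBall 0 R))
    (h0 : g 0 = 0) : ∃ c : ℝ, ∀ z : V, ‖z‖ ≤ R → ‖g z‖ = c * ‖z‖ := by
  obtain ⟨e, e', he, he', hee⟩ := exists_norm_eq_one_inner_eq_zero hV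
  have hmem : ∀ c : V, c ∈ Metric.closedBall (0 : V) R ↔ ‖c‖ ≤ R := by simp
  have hns : ∀ (t : ℝ) (v : V), ‖v‖ = 1 → ‖√t • v‖ = √t := by
    intro t v hv
    rw [norm_smul, hv, mul_one, Real.norm_of_nonneg (Real.sqrt_nonneg t)]
  have hle : ∀ t : ℝ, t ≤ R ^ 2 → √t ≤ R := fun t ht => Real.sqrt_le_iff.2 ⟨hR.le, ht⟩
  have hadd : ∀ s t, 0 ≤ s → 0 ≤ t → s + t ≤ R ^ 2 →
      ‖g (√(s + t) • e)‖ ^ 2 = ‖g (√s • e)‖ ^ 2 + ‖g (√t • e)‖ ^ 2 := by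
    intro s t hs ht hst
    set a := √s • e with ha
    set b := √t • e' with hb
    have hna : ‖a‖ = √s := hns _ _ he
    have hnb : ‖b‖ = √t := hns _ _ he'
    have hab : inner ℝ a b = 0 := by simp [a, b, inner_smul_left, inner_smul_right, hee]
    have haR : ‖a‖ ≤ R := hna ▸ hle _ (by linarith)
    have hbR : ‖b‖ ≤ R := hnb ▸ hle _ (by linarith)
    have hgab := hg.inner_eq_zero h0 haR hbR hab
    -- `c` is the apex of an isosceles triangle over the segment from `0` to `a`
    set c := (1 / 2 : ℝ) • a + √(3 / 4 * s + t) • e' with hc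
    have hae' : inner ℝ a e' = 0 := by simp [a, inner_smul_left, hee]
    have hs2 : √s ^ 2 = s := Real.sq_sqrt hs
    have ht2 : √t ^ 2 = t := Real.sq_sqrt ht
    have hq : √(3 / 4 * s + t) ^ 2 = 3 / 4 * s + t := Real.sq_sqrt (by positivity)
    have hnc : ‖c‖ ^ 2 = s + t := by
      rw [hc, norm_add_sq_real, hns _ _ he', norm_smul, inner_smul_left, inner_smul_right, hae',
        mul_pow, hna, hs2, hq]
      norm_num
      ring
    have hnca : ‖c - a‖ ^ 2 = s + t := by
      have : c - a = (-(1 / 2) : ℝ) • a + √(3 / 4 * s + t) • e' := by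
        rw [hc]; module
      rw [this, norm_add_sq_real, hns _ _ he', norm_smul, inner_smul_left, inner_smul_right, hae',
        mul_pow, hna, hs2, hq]
      norm_num
      ring
    have hnab : ‖b - a‖ ^ 2 = s + t := by
      rw [norm_sub_sq_real, real_inner_comm, hab, hna, hnb, hs2, ht2]; ring
    have hnc' : ‖c‖ = √(s + t) := by rw [← hnc, Real.sqrt_sq (norm_nonneg _)]
    have hcR : ‖c‖ ≤ R := hnc' ▸ hle _ hst
    have e1 : ‖g (√(s + t) • e)‖ = ‖g c‖ :=
      hg.norm_eq h0 (by rw [hns _ _ he]; exact hle _ hst) (by rw [hns _ _ he, hnc'])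
    have e2 : dist (g 0) (g c) = dist (g a) (g c) := by
      refine hg.dist_eq ((hmem _).2 (by simpa using hR.le)) ((hmem _).2 haR) ((hmem _).2 hcR) ?_
      rw [dist_zero_left, dist_comm, dist_eq_norm, ← sq_eq_sq₀ (norm_nonneg _) (norm_nonneg _),
        hnc, hnca]
    have e3 : dist (g c) (g a) = dist (g b) (g a) := by
      refine hg.dist_eq ((hmem _).2 hcR) ((hmem _).2 hbR) ((hmem _).2 haR) ?_
      rw [dist_eq_norm, dist_eq_norm, ← sq_eq_sq₀ (norm_nonneg _) (norm_nonneg _), hnca, hnab]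
    have e4 : ‖g c‖ = ‖g b - g a‖ := by
      rw [← dist_eq_norm, ← e3, dist_comm, ← e2, h0, dist_zero_left]
    have e5 : ‖g b‖ = ‖g (√t • e)‖ := hg.norm_eq h0 hbR (by rw [hnb, hns _ _ he])
    rw [e1, e4, norm_sub_sq_real, real_inner_comm, hgab, e5]
    ring
  refine ⟨‖g (R • e)‖ / R, fun z hz => ?_⟩
  have h := eq_mul_of_additive_of_nonneg (ψ := fun t => ‖g (√t • e)‖ ^ 2) (T := R ^ 2)
    (by positivity) hadd (fun t => by positivity) (t := ‖z‖ ^ 2) (by positivity) (by gcongr)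
  simp only [Real.sqrt_sq (norm_nonneg z), Real.sqrt_sq hR.le] at h
  have e1 : ‖g z‖ = ‖g (‖z‖ • e)‖ := hg.norm_eq h0 hz (by simp [norm_smul, he])
  rw [e1, ← sq_eq_sq₀ (norm_nonneg _) (by positivity), h]
  field_simp

/-- Weakly `1`-quasisymmetric maps of the unit ball, suitably normalised, are linear isometries. -/
theorem WeakQSOn.exists_linearIsometry [FiniteDimensional ℝ V] (hV : 2 ≤ Module.finrank ℝ V)
    {g : V → V} (hg : WeakQSOn 1 g (Metric.closedBall 0 1)) (h0 : g 0 = 0) {e : V}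
    (he : ‖e‖ = 1) (hge : ‖g e‖ = 1) : ∃ L : V →ₗᵢ[ℝ] V, ∀ z : V, ‖z‖ ≤ 1 → g z = L z := by
  have hmem : ∀ c : V, c ∈ Metric.closedBall (0 : V) 1 ↔ ‖c‖ ≤ 1 := by simp
  have hnorm : ∀ z : V, ‖z‖ ≤ 1 → ‖g z‖ = ‖z‖ := by
    obtain ⟨c, hc⟩ := hg.exists_norm_eq_mul hV one_pos h0
    have := hc e he.le
    rw [hge, he, mul_one] at this
    intro z hz
    rw [hc z hz, ← this, one_mul]
  have hhalf : ∀ z : V, ‖z‖ ≤ 1 → g z = (2 : ℝ) • g ((1 / 2 : ℝ) • z) := by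
    intro z hz
    have hz2 : ‖(1 / 2 : ℝ) • z‖ = ‖z‖ / 2 := by rw [norm_smul]; norm_num; ring
    have hz2' : ‖(1 / 2 : ℝ) • z‖ ≤ 1 := by rw [hz2]; linarith [norm_nonneg z]
    have h1 : dist (g z) (g ((1 / 2 : ℝ) • z)) = dist (g 0) (g ((1 / 2 : ℝ) • z)) := by
      refine hg.dist_eq ((hmem _).2 hz) ((hmem _).2 (by simp)) ((hmem _).2 hz2') ?_
      rw [dist_zero_left, dist_eq_norm]
      congr 1
      module
    rw [h0, dist_zero_left, dist_eq_norm, hnorm _ hz2', hz2] at h1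
    have h2 : ‖g z‖ = ‖z‖ := hnorm z hz
    have h3 : ‖g ((1 / 2 : ℝ) • z)‖ = ‖z‖ / 2 := by rw [hnorm _ hz2', hz2]
    -- Equality case of the triangle inequality: `g z` has twice the norm of the image of the
    -- midpoint and lies at that norm's distance from it.
    have h4 := norm_sub_sq_real (g z) (g ((1 / 2 : ℝ) • z))
    rw [h1, h2, h3] at h4
    have h5 : ‖g z - (2 : ℝ) • g ((1 / 2 : ℝ) • z)‖ ^ 2 = 0 := by
      rw [norm_sub_sq_real, norm_smul, inner_smul_right, h2, h3]
      norm_num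
      nlinarith
    have h6 := norm_eq_zero.1 (pow_eq_zero_iff (two_ne_zero)|>.1 h5)
    exact sub_eq_zero.1 h6
  have hsmall : ∀ a b : V, ‖a‖ ≤ 1 / 4 → ‖b‖ ≤ 1 / 4 → ‖g b - g a‖ = ‖b - a‖ := by
    intro a b ha hb
    by_cases ha0 : a = 0
    · subst ha0
      rw [h0, sub_zero, sub_zero, hnorm b (by linarith)]
    -- Recentre at `a`: the radius `1 / 2` stays inside the unit ball and still reaches `b - a`. The
    -- new scale factor is found at `-a`, whose image is known since `g 0 = 0`; this is why `a = 0`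
    -- is treated apart.
    have hg' : WeakQSOn 1 (fun z => g (z + a) - g a) (Metric.closedBall 0 (1 / 2)) := by
      have hin : ∀ z ∈ Metric.closedBall (0 : V) (1 / 2), z + a ∈ Metric.closedBall (0 : V) 1 := by
        intro z hz
        rw [hmem]
        have : ‖z‖ ≤ 1 / 2 := by simpa using hz
        exact (norm_add_le _ _).trans (by linarith)
      intro p hp q hq x hx hpq
      simp only [dist_sub_right]
      exact hg _ (hin _ hp) _ (hin _ hq) _ (hin _ hx) (by simpa using hpq)
    obtain ⟨c, hc⟩ := hg'.exists_norm_eq_mul hV (by norm_num) (by simp)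
    have h1 := hc (-a) (by rw [norm_neg]; linarith)
    rw [neg_add_cancel, h0, zero_sub, norm_neg, norm_neg, hnorm a (by linarith)] at h1
    have hc1 : c = 1 := by
      have := norm_pos_iff.2 ha0
      exact (mul_right_cancel₀ this.ne' (by linarith : c * ‖a‖ = 1 * ‖a‖))
    have h2 := hc (b - a) ((norm_sub_le _ _).trans (by linarith))
    rwa [sub_add_cancel, hc1, one_mul] at h2
  have hquarter : ∀ z : V, ‖z‖ ≤ 1 → g z = (4 : ℝ) • g ((1 / 4 : ℝ) • z) := by
    intro z hz
    rw [hhalf z hz, hhalf ((1 / 2 : ℝ) • z)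
      (by rw [norm_smul]; norm_num; linarith), smul_smul, smul_smul]
    norm_num
  have hdist : ∀ a b : V, ‖a‖ ≤ 1 → ‖b‖ ≤ 1 → ‖g b - g a‖ = ‖b - a‖ := by
    intro a b ha hb
    rw [hquarter a ha, hquarter b hb, ← smul_sub, norm_smul, hsmall, ← smul_sub, norm_smul,
      ← mul_assoc]
    · norm_num
    · rw [norm_smul]; norm_num; linarith
    · rw [norm_smul]; norm_num; linarith
  have hinner : ∀ a b : V, ‖a‖ ≤ 1 → ‖b‖ ≤ 1 → inner ℝ (g a) (g b) = inner ℝ a b := by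
    intro a b ha hb
    have h1 := norm_sub_sq_real (g a) (g b)
    rw [hdist b a hb ha, hnorm a ha, hnorm b hb, norm_sub_sq_real] at h1
    linarith
  let B := stdOrthonormalBasis ℝ V
  have hB1 : ∀ i, ‖B i‖ ≤ 1 := fun i => (B.orthonormal.1 i).le
  have hon : Orthonormal ℝ (fun i => g (B i)) := by
    constructor
    · intro i
      rw [hnorm _ (hB1 i), B.orthonormal.1 i]
    · intro i j hij
      change inner ℝ (g (B i)) (g (B j)) = 0
      rw [hinner _ _ (hB1 i) (hB1 j), B.orthonormal.2 hij]
  let C : OrthonormalBasis (Fin (Module.finrank ℝ V)) ℝ V :=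
    OrthonormalBasis.mk hon (by
      rw [(hon.linearIndependent).span_eq_top_of_card_eq_finrank' (by simp)])
  have hC : ∀ i, C i = g (B i) := fun i => by simp [C]
  refine ⟨(B.equiv C (Equiv.refl _)).toLinearIsometry, fun z hz => ?_⟩
  rw [← C.sum_repr' (g z)]
  change _ = B.equiv C (Equiv.refl _) z
  conv_rhs => rw [← B.sum_repr' z]
  rw [map_sum]
  refine Finset.sum_congr rfl fun i _ => ?_
  rw [map_smul, B.equiv_apply_basis, hC, hinner _ _ (hB1 i) hz]
  simp [hC]

end Rigidity

/-! ### Compactness: closeness to similarities -/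

section Approximation

variable {V : Type*} [NormedAddCommGroup V] [InnerProductSpace ℝ V]

/-- Move `p` along its own line towards the origin, possibly past it. Such a `q` is the comparison
point that controls the oscillation of a weakly quasisymmetric map near `p`. -/
theorem exists_norm_le_one_dist_eq {e : V} (he : ‖e‖ = 1) {η : ℝ} (hη : 0 ≤ η) (hη1 : η ≤ 1)
    (p : V) (hp : ‖p‖ ≤ 1) : ∃ q : V, ‖q‖ ≤ 1 ∧ dist q p = η := by
  by_cases hp0 : p = 0
  · subst hp0
    have : ‖η • e‖ = η := by rw [norm_smul, he, mul_one, Real.norm_of_nonneg hη]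
    exact ⟨η • e, by rwa [this], by rw [dist_zero_right, this]⟩
  · have hpos : 0 < ‖p‖ := norm_pos_iff.2 hp0
    have h1 : p - (η / ‖p‖) • p = ((‖p‖ - η) / ‖p‖) • p := by
      rw [sub_div, sub_smul, div_self hpos.ne', one_smul]
    refine ⟨p - (η / ‖p‖) • p, ?_, ?_⟩
    · rw [h1, norm_smul, norm_div, norm_norm, div_mul_cancel₀ _ hpos.ne', Real.norm_eq_abs,
        abs_le]
      constructor <;> linarith
    · rw [dist_eq_norm, sub_sub_cancel_left, norm_neg, norm_smul, norm_div, norm_norm,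
        div_mul_cancel₀ _ hpos.ne', Real.norm_of_nonneg hη]

variable [FiniteDimensional ℝ V]

/-- A pointwise limit along an ultrafilter of normalised weakly `H k`-quasisymmetric maps of the
unit ball with `H k → 1` is a linear isometry. -/
theorem exists_linearIsometry_tendsto_of_weakQSOn (hV : 2 ≤ Module.finrank ℝ V) {e : V}
    (he : ‖e‖ = 1) {ι : Type*} (U : Ultrafilter ι) {H : ι → ℝ} (hH : ∀ k, H k ≤ 2)
    (hH1 : Filter.Tendsto H U (nhds 1)) {G : ι → V → V}
    (hG : ∀ k, WeakQSOn (H k) (G k) (Metric.closedBall 0 1)) (hG0 : ∀ k, G k 0 = 0)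
    (hGe : ∀ k, ‖G k e‖ = 1) :
    ∃ L : V →ₗᵢ[ℝ] V, ∀ z : V, ‖z‖ ≤ 1 → Filter.Tendsto (fun k => G k z) U (nhds (L z)) := by
  have hmem : ∀ c : V, c ∈ Metric.closedBall (0 : V) 1 ↔ ‖c‖ ≤ 1 := by simp
  have hbd : ∀ z : V, ‖z‖ ≤ 1 → ∀ k, G k z ∈ Metric.closedBall (0 : V) 2 := by
    intro z hz k
    have := hG k z ((hmem z).2 hz) e ((hmem e).2 he.le) 0 ((hmem 0).2 (by simp))
      (by simpa [he] using hz)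
    rw [hG0, dist_zero_right, dist_zero_right, hGe] at this
    rw [mem_closedBall_zero_iff]
    linarith [hH k]
  have hlim : ∀ z : V, ∃ w : V, ‖z‖ ≤ 1 → Filter.Tendsto (fun k => G k z) U (nhds w) := by
    intro z
    by_cases hz : ‖z‖ ≤ 1
    · obtain ⟨w, -, hw⟩ := (isCompact_closedBall (0 : V) 2).ultrafilter_le_nhds
        (U.map fun k => G k z) (by
          rw [Filter.le_principal_iff]
          exact Filter.mem_map.2 (Filter.univ_mem' (hbd z hz)))
      exact ⟨w, fun _ => hw⟩
    · exact ⟨0, fun h => absurd h hz⟩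
  choose g hg using hlim
  have hg1 : WeakQSOn 1 g (Metric.closedBall 0 1) := by
    intro a ha b hb x hx hab
    have ta := hg a ((hmem a).1 ha)
    have tb := hg b ((hmem b).1 hb)
    have tx := hg x ((hmem x).1 hx)
    exact le_of_tendsto_of_tendsto' (ta.dist tx) (hH1.mul (tb.dist tx))
      fun k => hG k a ha b hb x hx hab
  have hg0 : g 0 = 0 := by
    have h := hg 0 (by simp)
    simp only [hG0] at h
    exact tendsto_nhds_unique h tendsto_const_nhds
  have hge : ‖g e‖ = 1 := by
    have h := (hg e he.le).norm
    simp only [hGe] at h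
    exact tendsto_nhds_unique h tendsto_const_nhds
  obtain ⟨L, hL⟩ := hg1.exists_linearIsometry hV hg0 he hge
  exact ⟨L, fun z hz => hL z hz ▸ hg z hz⟩

/-- Normalised weakly `(1 + δ)`-quasisymmetric maps of the unit ball are uniformly close to linear
isometries. -/
theorem exists_linearIsometry_near_of_weakQSOn (hV : 2 ≤ Module.finrank ℝ V) {e : V}
    (he : ‖e‖ = 1) {ε : ℝ} (hε : 0 < ε) :
    ∃ δ : ℝ, 0 < δ ∧ ∀ g : V → V, WeakQSOn (1 + δ) g (Metric.closedBall 0 1) → g 0 = 0 →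
      ‖g e‖ = 1 → ∃ L : V →ₗᵢ[ℝ] V, ∀ z : V, ‖z‖ ≤ 1 → ‖g z - L z‖ ≤ ε := by
  by_contra! hcon
  choose G hG hG0 hGe hGL using fun k : ℕ => hcon (1 / ((k : ℝ) + 1)) (by positivity)
  have hmem : ∀ c : V, c ∈ Metric.closedBall (0 : V) 1 ↔ ‖c‖ ≤ 1 := by simp
  have hH : ∀ k : ℕ, 1 + 1 / ((k : ℝ) + 1) ≤ 2 := by
    intro k
    have : 1 / ((k : ℝ) + 1) ≤ 1 := by
      rw [div_le_one (by positivity)]; linarith [(Nat.cast_nonneg k : (0 : ℝ) ≤ k)]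
    linarith
  let U : Ultrafilter ℕ := Filter.hyperfilter ℕ
  have hH1 : Filter.Tendsto (fun k : ℕ => 1 + 1 / ((k : ℝ) + 1)) U (nhds 1) := by
    have h := (tendsto_const_nhds (x := (1 : ℝ))).add
      (tendsto_one_div_add_atTop_nhds_zero_nat (𝕜 := ℝ))
    rw [add_zero] at h
    exact h.mono_left Nat.hyperfilter_le_atTop
  obtain ⟨L, hL⟩ := exists_linearIsometry_tendsto_of_weakQSOn hV he U hH hH1 hG hG0 hGe
  -- For `z` within `η` of a net point `p`, the companion `q p` at distance exactly `η` gives `dist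
  -- (G k z) (G k p) ≤ 2 * 3η`. The error at `p` and the displacement of `L` add `η` each, for a
  -- total of `8η`.
  set η : ℝ := min 1 (ε / 8) with hη
  have hη0 : 0 < η := by positivity
  have hη1 : η ≤ 1 := min_le_left _ _
  have hη8 : 8 * η ≤ ε := by linarith [min_le_right 1 (ε / 8)]
  obtain ⟨T, hT, hTfin, hcov⟩ := finite_cover_balls_of_compact
    (isCompact_closedBall (0 : V) 1) hη0
  choose! q hq1 hqd using exists_norm_le_one_dist_eq he hη0.le hη1
  have hclose : ∀ z : V, ‖z‖ ≤ 1 → ∀ᶠ k in U, ‖G k z - L z‖ ≤ η := by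
    intro z hz
    have h := (hL z hz).eventually (Metric.closedBall_mem_nhds _ hη0)
    exact h.mono fun k hk => by rwa [← dist_eq_norm]
  have hev : ∀ᶠ k in U, ∀ p ∈ T, ‖G k p - L p‖ ≤ η ∧ ‖G k (q p) - L (q p)‖ ≤ η := by
    rw [Filter.eventually_all_finite hTfin]
    intro p hp
    have hp1 := (hmem p).1 (hT hp)
    exact (hclose p hp1).and (hclose _ (hq1 p hp1))
  obtain ⟨k, hk⟩ := hev.exists
  obtain ⟨z, hz, hzε⟩ := hGL k L
  obtain ⟨p, hpT, hzp⟩ : ∃ p ∈ T, dist z p < η := by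
    have := hcov ((hmem z).2 hz)
    simpa using this
  have hp1 := (hmem p).1 (hT hpT)
  obtain ⟨hkp, hkq⟩ := hk p hpT
  have hLd : ∀ x y : V, ‖L x - L y‖ = dist x y := fun x y => by
    rw [← dist_eq_norm, L.dist_map]
  have h1 : dist (G k (q p)) (G k p) ≤ 3 * η := by
    have e1 : G k (q p) - G k p
        = (G k (q p) - L (q p)) + (L (q p) - L p) - (G k p - L p) := by abel
    rw [dist_eq_norm, e1]
    have := norm_sub_le ((G k (q p) - L (q p)) + (L (q p) - L p)) (G k p - L p)
    have := norm_add_le (G k (q p) - L (q p)) (L (q p) - L p)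
    have := hLd (q p) p
    have := hqd p hp1
    linarith
  have h2 : dist (G k z) (G k p) ≤ 6 * η := by
    have h3 := hG k z ((hmem z).2 hz) (q p) ((hmem _).2 (hq1 p hp1)) p (hT hpT)
      (by rw [hqd p hp1]; exact hzp.le)
    have h4 : (1 + 1 / ((k : ℝ) + 1)) * dist (G k (q p)) (G k p) ≤ 2 * (3 * η) := by
      gcongr
      exact hH k
    linarith
  have h5 : G k z - L z = (G k z - G k p) + (G k p - L p) - (L z - L p) := by abel
  have h6 := norm_sub_le ((G k z - G k p) + (G k p - L p)) (L z - L p)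
  have h7 := norm_add_le (G k z - G k p) (G k p - L p)
  have h8 := hLd z p
  rw [← dist_eq_norm (G k z)] at h7
  rw [h5] at hzε
  linarith

/-- A weakly `(1 + δ)`-quasisymmetric map of a ball is close to a similarity on the whole ball,
relative to the size of the image. -/
theorem exists_similarity_near_of_weakQSOn (hV : 2 ≤ Module.finrank ℝ V) {ε : ℝ} (hε : 0 < ε) :
    ∃ δ : ℝ, 0 < δ ∧ ∀ (g : V → V) (y : V) (R : ℝ), 0 < R →
      WeakQSOn (1 + δ) g (Metric.closedBall y R) → Set.InjOn g (Metric.closedBall y R) →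
      ∃ (c : ℝ) (L : V →ₗᵢ[ℝ] V), 0 < c ∧
        ∀ z ∈ Metric.closedBall y R, ‖g z - (g y + c • L (z - y))‖ ≤ ε * c * R := by
  obtain ⟨e, -, he, -, -⟩ := exists_norm_eq_one_inner_eq_zero hV
  obtain ⟨δ, hδ, h⟩ := exists_linearIsometry_near_of_weakQSOn hV he hε
  refine ⟨δ, hδ, fun g y R hR hg hinj => ?_⟩
  have hin : ∀ z : V, ‖z‖ ≤ 1 → y + R • z ∈ Metric.closedBall y R := by
    intro z hz
    rw [Metric.mem_closedBall, dist_eq_norm, add_sub_cancel_left, norm_smul,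
      Real.norm_of_nonneg hR.le]
    exact mul_le_of_le_one_right hR.le hz
  have hne : g (y + R • e) - g y ≠ 0 := by
    rw [sub_ne_zero]
    intro heq
    have := hinj (hin e he.le) (Metric.mem_closedBall_self hR.le) heq
    rw [add_eq_left, smul_eq_zero] at this
    rcases this with h0 | h0
    · exact hR.ne' h0
    · simp [h0] at he
  -- Injectivity makes `m` positive, so `g` can be rescaled to the normalised situation; the
  -- similarity ratio is then `m / R`.
  set m := ‖g (y + R • e) - g y‖ with hm
  have hm0 : 0 < m := norm_pos_iff.2 hne
  obtain ⟨L, hL⟩ := h (fun z => m⁻¹ • (g (y + R • z) - g y)) (by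
      intro a ha b hb x hx hab
      have key := hg _ (hin a (by simpa using ha)) _ (hin b (by simpa using hb)) _
        (hin x (by simpa using hx)) (by
          simp only [dist_add_left, dist_smul₀]
          gcongr)
      simp only [dist_smul₀, dist_sub_right]
      rw [mul_left_comm]
      gcongr) (by simp) (by
      rw [norm_smul, norm_inv, Real.norm_of_nonneg hm0.le, ← hm, inv_mul_cancel₀ hm0.ne'])
  refine ⟨m / R, L, by positivity, fun z hz => ?_⟩
  have hz1 : ‖R⁻¹ • (z - y)‖ ≤ 1 := by
    rw [norm_smul, norm_inv, Real.norm_of_nonneg hR.le, ← dist_eq_norm, inv_mul_le_one₀ hR]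
    exact hz
  have h1 := hL _ hz1
  rw [smul_inv_smul₀ hR.ne', add_sub_cancel, map_smul] at h1
  have h2 : g z - (g y + (m / R) • L (z - y))
      = m • (m⁻¹ • (g z - g y) - R⁻¹ • L (z - y)) := by
    rw [smul_sub, smul_inv_smul₀ hm0.ne', smul_smul, div_eq_mul_inv]
    abel
  rw [h2, norm_smul, Real.norm_of_nonneg hm0.le]
  calc m * ‖m⁻¹ • (g z - g y) - R⁻¹ • L (z - y)‖ ≤ m * ε := by gcongr
    _ = ε * (m / R) * R := by field_simp

end Approximation

/-! ### Restriction to ℝⁿ and comparison of affine maps -/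

theorem norm_sq_euclideanIncl (n m : ℕ) (x : EuclideanSpace ℝ (Fin n)) :
    ‖euclideanIncl n (n + m) x‖ ^ 2 = ‖x‖ ^ 2 := by
  rw [EuclideanSpace.norm_sq_eq, EuclideanSpace.norm_sq_eq, Fin.sum_univ_add]
  simp [euclideanIncl]

/-- The inclusion `ℝⁿ → ℝᴺ` as a linear isometry. -/
noncomputable def euclideanInclIsometry {n N : ℕ} (h : n ≤ N) :
    EuclideanSpace ℝ (Fin n) →ₗᵢ[ℝ] EuclideanSpace ℝ (Fin N) where
  toFun := euclideanIncl n N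
  map_add' x y := by
    ext i
    by_cases hi : (i : ℕ) < n <;> simp [euclideanIncl, hi]
  map_smul' c x := by
    ext i
    by_cases hi : (i : ℕ) < n <;> simp [euclideanIncl, hi]
  norm_map' x := by
    obtain ⟨m, rfl⟩ := Nat.exists_eq_add_of_le h
    exact (sq_eq_sq₀ (norm_nonneg _) (norm_nonneg _)).1 (norm_sq_euclideanIncl n m x)

theorem linearOpNorm_smul_linearIsometry {n N : ℕ} (hn : 1 ≤ n) {c : ℝ} (hc : 0 ≤ c)
    (L : EuclideanSpace ℝ (Fin n) →ₗᵢ[ℝ] EuclideanSpace ℝ (Fin N)) :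
    linearOpNorm (c • L.toLinearMap) = c := by
  have : Nonempty (Fin n) := ⟨⟨0, hn⟩⟩
  have h : LinearMap.toContinuousLinearMap (c • L.toLinearMap) = c • L.toContinuousLinearMap := by
    ext1 v; rfl
  rw [linearOpNorm, h, norm_smul, L.norm_toContinuousLinearMap, mul_one, Real.norm_of_nonneg hc]

/-- Affine maps that are close on a ball have close linear parts. -/
theorem linearOpNorm_sub_le_of_norm_sub_le {n N : ℕ}
    (A B : EuclideanSpace ℝ (Fin n) →ᵃ[ℝ] EuclideanSpace ℝ (Fin N))
    {w : EuclideanSpace ℝ (Fin n)} {R K : ℝ} (hR : 0 < R)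
    (h : ∀ z ∈ Metric.closedBall w R, ‖A z - B z‖ ≤ K) :
    linearOpNorm (A.linear - B.linear) ≤ K / R := by
  have hK : 0 ≤ K := (norm_nonneg _).trans (h w (Metric.mem_closedBall_self hR.le))
  refine ContinuousLinearMap.opNorm_le_bound _ (by positivity) fun v => ?_
  change ‖(A.linear - B.linear) v‖ ≤ K / R * ‖v‖
  by_cases hv : v = 0
  · simp [hv]
  have hv0 : 0 < ‖v‖ := norm_pos_iff.2 hv
  set u := (R / ‖v‖) • v with hu
  have hnu : ‖u‖ = R := by
    rw [hu, norm_smul, norm_div, norm_norm, div_mul_cancel₀ _ hv0.ne', Real.norm_of_nonneg hR.le]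
  have h1 := h (u +ᵥ w) (by simp [dist_eq_norm, hnu])
  have h2 := h (-u +ᵥ w) (by simp [dist_eq_norm, hnu])
  rw [A.map_vadd, B.map_vadd] at h1 h2
  -- Subtracting the values at antipodal points cancels the translation parts, giving the bound `K /
  -- R` without an extra factor 2.
  have h3 : (2 : ℝ) • (A.linear - B.linear) u
      = ((A.linear u +ᵥ A w) - (B.linear u +ᵥ B w))
        - ((A.linear (-u) +ᵥ A w) - (B.linear (-u) +ᵥ B w)) := by
    simp only [vadd_eq_add, map_neg, LinearMap.sub_apply]
    module
  have h4 : 2 * ‖(A.linear - B.linear) u‖ ≤ K + K := by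
    calc 2 * ‖(A.linear - B.linear) u‖ = ‖(2 : ℝ) • (A.linear - B.linear) u‖ := by
          rw [norm_smul]; norm_num
      _ ≤ K + K := by rw [h3]; exact (norm_sub_le _ _).trans (add_le_add h1 h2)
  have h5 : (A.linear - B.linear) v = (‖v‖ / R) • (A.linear - B.linear) u := by
    rw [hu, map_smul, smul_smul]
    have : ‖v‖ / R * (R / ‖v‖) = 1 := by field_simp
    rw [this, one_smul]
  rw [h5, norm_smul, norm_div, norm_norm, Real.norm_of_nonneg hR.le]
  calc ‖v‖ / R * ‖(A.linear - B.linear) u‖ ≤ ‖v‖ / R * K := by gcongr; linarith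
    _ = K / R * ‖v‖ := by ring

/-- Two balls of comparable radii whose centres are not too far apart share a ball of comparable
radius. -/
theorem exists_closedBall_subset_inter {V : Type*} [NormedAddCommGroup V] [NormedSpace ℝ V]
    {y z : V} {ρ σ : ℝ} (h1 : ρ ≤ 2 * σ) (h2 : σ ≤ 2 * ρ) (h : dist y z ≤ 2 * max ρ σ) :
    ∃ w, Metric.closedBall w (max ρ σ / 2) ⊆
      Metric.closedBall y (2 * ρ) ∩ Metric.closedBall z (2 * σ) := by
  wlog hle : σ ≤ ρ generalizing y z ρ σ
  · obtain ⟨w, hw⟩ := this h2 h1 (by rwa [dist_comm, max_comm]) (not_le.1 hle).le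
    exact ⟨w, by rwa [max_comm, Set.inter_comm]⟩
  rw [max_eq_left hle] at h ⊢
  -- The centre lies nearer the smaller ball: at distance at most `3ρ / 2` from `y` and `ρ / 2` from
  -- `z`, so adding the radius `ρ / 2` gives `2ρ` and `ρ ≤ 2σ`.
  refine ⟨z + (1 / 4 : ℝ) • (y - z), Set.subset_inter ?_ ?_⟩
  · refine Metric.closedBall_subset_closedBall' ?_
    have : z + (1 / 4 : ℝ) • (y - z) - y = (-(3 / 4) : ℝ) • (y - z) := by module
    rw [dist_eq_norm, this, norm_smul, ← dist_eq_norm]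
    norm_num
    linarith
  · refine Metric.closedBall_subset_closedBall' ?_
    rw [dist_eq_norm, add_sub_cancel_left, norm_smul, ← dist_eq_norm]
    norm_num
    linarith

/-- A small weak quasisymmetry defect gives the weak quasisymmetry inequality for the extension
by zero. -/
theorem weakQSOn_of_weakQuasisymmetryDefect_le {V : Type*} [MetricSpace V] {Y S : Set V}
    (hSY : S ⊆ Y) {f : Y → V} {g : V → V} (hgf : ∀ y : Y, g y = f y) {δ : ℝ} (hδ : 0 < δ)
    (h : weakQuasisymmetryDefect f ((fun y : Y => (y : V)) ⁻¹' S) ≤ ENNReal.ofReal (δ / 2)) :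
    WeakQSOn (1 + δ) g S := by
  have h1 : weakQuasisymmetryConst f ((fun y : Y => (y : V)) ⁻¹' S) < ENNReal.ofReal (1 + δ) := by
    rw [weakQuasisymmetryDefect, tsub_le_iff_right, ← ENNReal.ofReal_one,
      ← ENNReal.ofReal_add (by positivity) zero_le_one] at h
    -- The slack between `δ / 2` and `δ` gives the strict inequality needed to extract an admissible
    -- `H` from the infimum.
    exact h.trans_lt ((ENNReal.ofReal_lt_ofReal_iff (by positivity)).2 (by linarith))
  simp only [weakQuasisymmetryConst, iInf_lt_iff] at h1
  obtain ⟨H, ⟨-, hH⟩, hlt⟩ := h1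
  have hlt' := (ENNReal.ofReal_lt_ofReal_iff (by positivity)).1 hlt
  intro a ha b hb x hx hab
  have key := hH ⟨a, hSY ha⟩ ha ⟨b, hSY hb⟩ hb ⟨x, hSY hx⟩ hx hab
  rw [← hgf, ← hgf, ← hgf] at key
  exact key.trans (by gcongr)

/-! ### The main theorem -/

theorem mainTheorem7 (N : ℕ) (hN : 2 ≤ N) (τ : ℝ) (hτ : 0 < τ) :
    ∃ τstar : ℝ, 0 < τstar ∧
      ∀ (n : ℕ), 1 ≤ n → n ≤ N →
      ∀ (x : EuclideanSpace ℝ (Fin n)) (r : ℝ), 0 < r →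
      ∀ (Y : Set (EuclideanSpace ℝ (Fin N))),
        Metric.closedBall (euclideanIncl n N x) (3 * r) ⊆ Y →
      ∀ (f : Y → EuclideanSpace ℝ (Fin N)),
        IsQuasisymmetric f →
        weakQuasisymmetryDefect f
            ((fun y : Y => (y : EuclideanSpace ℝ (Fin N))) ⁻¹'
              Metric.closedBall (euclideanIncl n N x) (3 * r)) ≤ ENNReal.ofReal τstar →
        IsAlmostAffineOver (restrictToSubspace n f) τ (Metric.closedBall x r) := by
  classical
  -- Linear parts will differ by at most `4ε` times the sum of their norms. With `4ε ≤ 1/3` this sum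
  -- is at most three times the smaller norm, giving `12ε ≤ τ`.
  set ε : ℝ := min (1 / 12) (τ / 12) with hεdef
  have hε : 0 < ε := by positivity
  have hε1 : 12 * ε ≤ 1 := by linarith [min_le_left (1 / 12) (τ / 12)]
  have hε2 : 12 * ε ≤ τ := by linarith [min_le_right (1 / 12) (τ / 12)]
  obtain ⟨δ, hδ, hsim⟩ := exists_similarity_near_of_weakQSOn
    (V := EuclideanSpace ℝ (Fin N)) (by simpa using hN) hε
  refine ⟨δ / 2, by positivity, fun n hn hnN x r hr Y hY f hf hdef => ?_⟩
  let I := euclideanInclIsometry hnN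
  have hI : ∀ z, euclideanIncl n N z = I z := fun z => rfl
  rw [hI] at hY hdef
  let g : EuclideanSpace ℝ (Fin N) → EuclideanSpace ℝ (Fin N) :=
    fun z => if h : z ∈ Y then f ⟨z, h⟩ else 0
  have hgf : ∀ y : Y, g y = f y := fun y => by simp [g]
  have hg := weakQSOn_of_weakQuasisymmetryDefect_le hY hgf hδ hdef
  have hinj : Set.InjOn g (Metric.closedBall (I x) (3 * r)) := by
    intro a ha b hb hab
    have h1 := hgf ⟨a, hY ha⟩
    have h2 := hgf ⟨b, hY hb⟩
    have := hf.1.injective (h1.symm.trans (hab.trans h2))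
    exact congrArg Subtype.val this
  have hmemI : ∀ (a b : EuclideanSpace ℝ (Fin n)) (R : ℝ),
      a ∈ Metric.closedBall b R → I a ∈ Metric.closedBall (I b) R := by
    intro a b R h
    rwa [Metric.mem_closedBall, I.dist_map]
  -- Scales are truncated at `r`, as `2r` is already the diameter bound of the ball `E`. The doubled
  -- radius stays inside the `3r` ball and leaves room for the balls of neighbouring pairs to
  -- overlap substantially.
  have hloc : ∀ (y : EuclideanSpace ℝ (Fin n)) (s : ℝ), y ∈ Metric.closedBall x r → 0 < s →
      ∃ (c : ℝ) (L : EuclideanSpace ℝ (Fin N) →ₗᵢ[ℝ] EuclideanSpace ℝ (Fin N)), 0 < c ∧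
        ∀ z ∈ Metric.closedBall y (2 * min s r),
          ‖g (I z) - (c • L (I (z - y)) + g (I y))‖ ≤ ε * c * (2 * min s r) := by
    intro y s hy hs
    have hsub : Metric.closedBall (I y) (2 * min s r) ⊆ Metric.closedBall (I x) (3 * r) := by
      refine Metric.closedBall_subset_closedBall' ?_
      rw [I.dist_map]
      have h1 : dist y x ≤ r := hy
      linarith [min_le_right s r]
    obtain ⟨c, L, hc, hL⟩ := hsim g (I y) (2 * min s r) (by positivity)
      (fun a ha b hb z hz => hg a (hsub ha) b (hsub hb) z (hsub hz)) (hinj.mono hsub)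
    refine ⟨c, L, hc, fun z hz => ?_⟩
    rw [map_sub, add_comm]
    exact hL _ (hmemI _ _ _ hz)
  choose! c L hc hL using hloc
  let A : EuclideanSpace ℝ (Fin n) → ℝ →
      (EuclideanSpace ℝ (Fin n) →ᵃ[ℝ] EuclideanSpace ℝ (Fin N)) := fun y s =>
    AffineMap.mk' (fun z => c y s • L y s (I (z - y)) + g (I y))
      (c y s • ((L y s).comp I).toLinearMap) y (fun z => by simp)
  have hAz : ∀ y s z, A y s z = c y s • L y s (I (z - y)) + g (I y) := fun y s z => rfl
  have hAn : ∀ y s, y ∈ Metric.closedBall x r → 0 < s → linearOpNorm (A y s).linear = c y s :=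
    fun y s hy hs => linearOpNorm_smul_linearIsometry hn (hc y s hy hs).le ((L y s).comp I)
  refine ⟨fun z hz => hY (hmemI _ _ _ (Metric.closedBall_subset_closedBall (by linarith) hz)),
    A, ?_, ?_⟩
  · intro y hy z hz s t hs ht hyz hst1 hst2
    rw [le_div_iff₀ ht] at hst1
    rw [div_le_iff₀ ht] at hst2
    have hyz2 : dist y z ≤ 2 * r := by
      have h1 : dist y x ≤ r := hy
      have h2 : dist z x ≤ r := hz
      linarith [dist_triangle_right y z x]
    -- If truncation takes effect, the diameter bound `2r` replaces the hypothesis on `dist y z`.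
    have hd : dist y z ≤ 2 * max (min s r) (min t r) := by
      rw [← min_max_distrib_right]
      rcases le_total (max s t) r with h | h
      · rw [min_eq_left h]
        linarith [hs.trans_le (le_max_left s t)]
      · rwa [min_eq_right h]
    have hr1 : min s r ≤ 2 * min t r := by
      rcases le_total t r with h | h
      · rw [min_eq_left h]; linarith [min_le_left s r]
      · rw [min_eq_right h]; linarith [min_le_right s r]
    have hr2 : min t r ≤ 2 * min s r := by
      rcases le_total s r with h | h
      · rw [min_eq_left h]; linarith [min_le_left t r]
      · rw [min_eq_right h]; linarith [min_le_right t r]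
    obtain ⟨w, hw⟩ := exists_closedBall_subset_inter hr1 hr2 hd
    set ρ := max (min s r) (min t r) with hρ
    have hρ0 : 0 < ρ := lt_max_of_lt_left (by positivity)
    have hcy := hc y s hy hs
    have hcz := hc z t hz ht
    have hclose : ∀ v ∈ Metric.closedBall w (ρ / 2),
        ‖A y s v - A z t v‖ ≤ ε * (c y s + c z t) * (2 * ρ) := by
      intro v hv
      have h1 := hL y s hy hs v (hw hv).1
      have h2 := hL z t hz ht v (hw hv).2
      rw [← hAz] at h1 h2
      have h3 : A y s v - A z t v = (g (I v) - A z t v) - (g (I v) - A y s v) := by abel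
      have h4 : ε * c y s * (2 * min s r) ≤ ε * c y s * (2 * ρ) := by
        gcongr; exact le_max_left _ _
      have h5 : ε * c z t * (2 * min t r) ≤ ε * c z t * (2 * ρ) := by
        gcongr; exact le_max_right _ _
      rw [h3]
      refine (norm_sub_le _ _).trans ?_
      linarith
    have hlin := linearOpNorm_sub_le_of_norm_sub_le _ _ (half_pos hρ0) hclose
    have hlin' : linearOpNorm ((A y s).linear - (A z t).linear)
        ≤ 4 * ε * (c y s + c z t) := by
      refine hlin.trans_eq ?_
      field_simp
      ring
    -- The scale factors are the operator norms, so closeness of the linear parts first shows that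
    -- the factors are within a factor 2 of each other; their sum can then be replaced by their
    -- minimum.
    have hnd : |c y s - c z t| ≤ linearOpNorm ((A y s).linear - (A z t).linear) := by
      have h := abs_norm_sub_norm_le (LinearMap.toContinuousLinearMap (A y s).linear)
        (LinearMap.toContinuousLinearMap (A z t).linear)
      rw [← map_sub] at h
      have e1 := hAn y s hy hs
      have e2 := hAn z t hz ht
      rw [linearOpNorm] at e1 e2 ⊢
      rwa [e1, e2] at h
    have hsum : 4 * ε * (c y s + c z t) ≤ 1 / 3 * (c y s + c z t) := by
      gcongr
      linarith
    obtain ⟨hl, hu⟩ := abs_le.1 (hnd.trans (hlin'.trans hsum))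
    rw [hAn y s hy hs, hAn z t hz ht]
    have h3 : c y s + c z t ≤ 3 * min (c y s) (c z t) := by
      rcases le_total (c y s) (c z t) with h | h
      · rw [min_eq_left h]; linarith
      · rw [min_eq_right h]; linarith
    have hm : 0 < min (c y s) (c z t) := lt_min hcy hcz
    calc linearOpNorm ((A y s).linear - (A z t).linear)
        ≤ 4 * ε * (c y s + c z t) := hlin'
      _ ≤ 4 * ε * (3 * min (c y s) (c z t)) := by gcongr
      _ = 12 * ε * min (c y s) (c z t) := by ring
      _ ≤ τ * min (c y s) (c z t) := by gcongr
  · intro y hy s hs z hzE hz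
    have hz2 : (z : EuclideanSpace ℝ (Fin n)) ∈ Metric.closedBall y (2 * min s r) := by
      rw [Metric.mem_closedBall]
      rcases le_total s r with h | h
      · rw [min_eq_left h]
        have : dist (z : EuclideanSpace ℝ (Fin n)) y ≤ s := hz
        linarith
      · rw [min_eq_right h]
        have h1 : dist y x ≤ r := hy
        have h2 : dist (z : EuclideanSpace ℝ (Fin n)) x ≤ r := hzE
        linarith [dist_triangle_right (z : EuclideanSpace ℝ (Fin n)) y x]
    have h1 := hL y s hy hs z hz2
    have hfz : restrictToSubspace n f z = g (I z) := (hgf ⟨_, z.2⟩).symm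
    have hcy := hc y s hy hs
    rw [hfz, hAz, hAn y s hy hs]
    calc _ ≤ ε * c y s * (2 * min s r) := h1
      _ ≤ ε * c y s * (2 * s) := by gcongr; exact min_le_left _ _
      _ = 2 * ε * c y s * s := by ring
      _ ≤ τ * c y s * s := by gcongr; linarith
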